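/- Let $n$ agents communicate over directed graphs $\mathcal G(t)=(V,\mathcal E(t))$, $V=\{v_1,\dots,v_n\}$, $t\in\mathbb N=\{0,1,2,\dots\}$, where $(v_j,v_i)\in\mathcal E(t)$ means that $v_i$ receives information from $v_j$. For each $t$ let $A(t)=(a_{ij}(t))\in\mathbb R^{n\times n}$ be a matrix with nonnegative entries and row sums equal to $1$, such that $a_{ij}(t)=0$ whenever $i\ne j$ and $(v_j,v_i)\notin\mathcal E(t)$. Assume that there is a constant $\beta>0$ such that for every $t$ all diagonal entries of $A(t)$ are at least $\beta$, and $\mathcal G(t)$ has a subgraph on the whole vertex set $V$ which is rooted (some vertex has a directed path to every other vertex) and satisfies $a_{ij}(t)\ge\beta$ for each of its edges $(v_j,v_i)$. Let $f_1,\dots,f_n:\mathbb R\to\mathbb R$ be convex functions whose subgradients are all bounded in absolute value by a constant $L$, let $(\alpha_t)_{t\in\mathbb N}$ be a sequence of nonnegative step-sizes, and let $x(t)\in\mathbb R^n$ satisfy $$x(t+1)=A(t)x(t)-\alpha_t d(t),\qquad t\in\mathbb N,$$ where $d_i(t)$ is a subgradient of $f_i$ at the $i$-th entry of $A(t)x(t)$.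 For $t\ge s$ put $\Phi(t,s)=A(t)A(t-1)\cdots A(s)$. Let $\|\cdot\|$ be the Euclidean norm and $\mathbf 1$ the all-ones vector. Then for each $s\in\mathbb N$ there is a stochastic vector $\mathbf q_s$ (nonnegative entries with sum $1$) with $\lim_{t\to\infty}\Phi(t,s)=\mathbf 1\mathbf q_s'$, and with $y(t)=\mathbf q_t'x(t)$ the following hold. 1. If $\alpha_t\to0$, then $\lim_{t\to\infty}\|x(t)-\mathbf 1y(t)\|=0$. 2. If $\sum_t\alpha_t^2<\infty$, then $\sum_t\alpha_t\|x(t)-\mathbf 1y(t)\|<\infty$. 3. Suppose that all the matrices $A(t)$ have a common left eigenvector $\mathbf q'=(q_1,\dots,q_n)$ for the eigenvalue $1$, that is, $\mathbf q'A(t)=\mathbf q'$ for all $t$, with its sign chosen so that $\sum_i q_i>0$. If $\sum_t\alpha_t=\infty$, $\sum_t\alpha_t^2<\infty$, and the function $\sum_{i=1}^n q_if_i$ has a minimizer on $\mathbb R$, then there is a minimizer $x^*$ of $\sum_{i=1}^n q_if_i$ such that $\lim_{t\to\infty}x_i(t)=x^*$ for all $i$. -/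

import Mathlib

open Filter Topology

/-- `d` is a subgradient of `f : ℝ → ℝ` at `x`. -/
def IsSubgradientAt (f : ℝ → ℝ) (x d : ℝ) : Prop :=
  ∀ z : ℝ, f x + d * (z - x) ≤ f z

/-- A directed graph is rooted if from some vertex there is a directed path to every other
vertex. Here `H.Adj j i` is the edge `(j, i)`, along which `i` receives information from `j`. -/
def Digraph.IsRooted {V : Type*} (H : Digraph V) : Prop :=
  ∃ r : V, ∀ v : V, Relation.ReflTransGen H.Adj r v

/-- `A` is a matrix of consensus weights on the communication graph `E`: it is row-stochastic
(with nonnegative entries), and off the diagonal the weight `A i j` may be nonzero only if `j` is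
an in-neighbor of `i`. -/
def IsConsensusWeights {n : ℕ} (E : Digraph (Fin n)) (A : Matrix (Fin n) (Fin n) ℝ) : Prop :=
  A ∈ Matrix.rowStochastic ℝ (Fin n) ∧ ∀ i j, i ≠ j → ¬ E.Adj j i → A i j = 0

/-- All diagonal entries of `A` are at least `β`, and the graph `E` has a (spanning) rooted
subgraph all of whose edges carry a weight of at least `β` in `A`. -/
def HasRootedSubgraph {n : ℕ} (E : Digraph (Fin n)) (A : Matrix (Fin n) (Fin n) ℝ) (β : ℝ) :
    Prop :=
  (∀ i, β ≤ A i i) ∧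
    ∃ H : Digraph (Fin n), H ≤ E ∧ H.IsRooted ∧ ∀ i j, H.Adj j i → β ≤ A i j

/-- The backward product `Φ(t, s) = A(t) A(t-1) ⋯ A(s)` for `s ≤ t`, and `Φ(t, s) = 0` for
`t < s`. -/
def transitionMatrix {n : ℕ} (A : ℕ → Matrix (Fin n) (Fin n) ℝ) :
    ℕ → ℕ → Matrix (Fin n) (Fin n) ℝ
  | 0, s => if s = 0 then A 0 else 0
  | t + 1, s => if s = t + 1 then A (t + 1) else A (t + 1) * transitionMatrix A t s

/-- The vectors `q s` are stochastic and `Φ(t, s) → 𝟏 (q s)'` as `t → ∞`, for every `s`. -/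
def IsLimitVectors {n : ℕ} (A : ℕ → Matrix (Fin n) (Fin n) ℝ) (q : ℕ → Fin n → ℝ) : Prop :=
  ∀ s, q s ∈ stdSimplex ℝ (Fin n) ∧
    Tendsto (fun t => transitionMatrix A t s) atTop (𝓝 (Matrix.of fun _ j => q s j))

/-- The Euclidean distance `‖x - 𝟏 y‖` of the state vector `x` from the consensus vector `𝟏 y`. -/
noncomputable def consensusError {n : ℕ} (x : Fin n → ℝ) (y : ℝ) : ℝ :=
  ‖(WithLp.toLp 2 (fun i => x i - y) : EuclideanSpace ℝ (Fin n))‖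

/-- The states `x`, with subgradients `d`, follow the consensus-based subgradient dynamics:
`x(t+1) = A(t) x(t) - α_t d(t)`, where `d_i(t)` is a subgradient of `f_i` at the `i`-th entry of
`A(t) x(t)`. -/
def FollowsDynamics {n : ℕ} (A : ℕ → Matrix (Fin n) (Fin n) ℝ) (f : Fin n → ℝ → ℝ)
    (α : ℕ → ℝ) (x d : ℕ → Fin n → ℝ) : Prop :=
  ∀ t, (∀ i, IsSubgradientAt (f i) ((A t).mulVec (x t) i) (d t i)) ∧
    x (t + 1) = (A t).mulVec (x t) - α t • d t

/-! Disagreement is measured by the spread `max - min` of the state. Among `n²` consecutive times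
some vertex `r` is a root at least `n` times. The rows whose entry in column `r` of the running
product of `k` factors is at least `β ^ k` are never lost, thanks to the diagonal, and gain a member
whenever `r` is a root and some row is missing. So every window of length `N = n²` has a column
bounded below by `β ^ N` and contracts the spread by a uniform `μ < 1`
(`exists_spread_contraction`). This makes `Φ(t, s)` converge.

Along the trajectory the spread `e` satisfies `e (t + N) ≤ μ * e t + b t`, with `b` a multiple of a
sum of `N` consecutive step sizes. If `b → 0` then `e → 0`; if `b` is square-summable then so is
`e`, and `α * e ≤ α² + e²` is summable.

A common left eigenvector is a positive multiple of the limit vector `p 0`, so averaging with `p 0`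
commutes with the consensus step. The average then follows an approximate subgradient method with
summable errors (`sq_average_sub_le`), and a quasi-Fejér argument gives convergence to a minimizer.
-/

/-! ### Perturbed scalar contractions -/

/-- A nonnegative sequence that contracts up to a vanishing perturbation tends to zero. -/
theorem tendsto_zero_of_contraction {u b : ℕ → ℝ} {μ : ℝ} (hμ0 : 0 ≤ μ) (hμ1 : μ < 1)
    (hu : ∀ k, 0 ≤ u k) (hb : Tendsto b atTop (𝓝 0)) (h : ∀ k, u (k + 1) ≤ μ * u k + b k) :
    Tendsto u atTop (𝓝 0) := by
  rw [Metric.tendsto_atTop]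
  intro ε hε
  -- With this threshold `ε / 2` is the fixed point of the perturbed recursion.
  have hε' : 0 < ε / 2 * (1 - μ) := mul_pos (half_pos hε) (by linarith)
  obtain ⟨K, hK⟩ := Metric.tendsto_atTop.1 hb _ hε'
  have hstep : ∀ j, u (K + j) ≤ ε / 2 + μ ^ j * u K := by
    intro j
    induction j with
    | zero => simp; linarith
    | succ j ih =>
      have h1 := h (K + j)
      have h2 := hK (K + j) (by omega)
      rw [Real.dist_eq, sub_zero] at h2
      have h3 := (abs_lt.1 h2).2
      have h4 := mul_le_mul_of_nonneg_left ih hμ0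
      have h5 : μ ^ (j + 1) * u K = μ * (μ ^ j * u K) := by ring
      rw [← add_assoc, h5]
      nlinarith
  have hpow : Tendsto (fun j => μ ^ j * u K) atTop (𝓝 0) := by
    simpa using (tendsto_pow_atTop_nhds_zero_of_lt_one hμ0 hμ1).mul_const (u K)
  obtain ⟨J, hJ⟩ := Metric.tendsto_atTop.1 hpow _ (half_pos hε)
  refine ⟨K + J, fun k hk => ?_⟩
  obtain ⟨j, rfl⟩ := Nat.exists_eq_add_of_le (show K ≤ k by omega)
  have h1 := hJ j (by omega)
  rw [Real.dist_eq, sub_zero] at h1 ⊢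
  have h2 := (abs_lt.1 h1).2
  rw [abs_of_nonneg (hu _)]
  linarith [hstep j]

/-- The version of `tendsto_zero_of_contraction` for a contraction over `N` steps. -/
theorem tendsto_zero_of_contraction_lag {e b : ℕ → ℝ} {μ : ℝ} {N : ℕ} (hN : 0 < N) (hμ0 : 0 ≤ μ)
    (hμ1 : μ < 1) (he : ∀ t, 0 ≤ e t) (hb : Tendsto b atTop (𝓝 0))
    (h : ∀ t, e (t + N) ≤ μ * e t + b t) : Tendsto e atTop (𝓝 0) := by
  have hres : ∀ r, Tendsto (fun k => e (k * N + r)) atTop (𝓝 0) := by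
    intro r
    have hsub : Tendsto (fun k => k * N + r) atTop atTop :=
      tendsto_atTop_mono (fun k => (Nat.le_mul_of_pos_right k hN).trans (Nat.le_add_right _ r))
        tendsto_id
    refine tendsto_zero_of_contraction hμ0 hμ1 (fun k => he _) (hb.comp hsub) fun k => ?_
    have := h (k * N + r)
    rwa [show k * N + r + N = (k + 1) * N + r by ring] at this
  -- Summing over all residues mod `N` dominates `e t`, which is the term `r = t % N`.
  have hsum : Tendsto (fun t => ∑ r ∈ Finset.range N, e (t / N * N + r)) atTop (𝓝 0) := by
    have := tendsto_finsetSum (Finset.range N) fun r _ =>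
      (hres r).comp (Nat.tendsto_div_const_atTop hN.ne')
    simpa using this
  refine squeeze_zero he (fun t => ?_) hsum
  have := Finset.single_le_sum (f := fun r => e (t / N * N + r)) (fun r _ => he _)
    (Finset.mem_range.2 (Nat.mod_lt t hN))
  simpa only [Nat.div_add_mod'] using this

/-- Square-summability is inherited through a contraction over `N` steps. -/
theorem summable_sq_of_contraction_lag {e b : ℕ → ℝ} {μ : ℝ} {N : ℕ} (hμ0 : 0 ≤ μ)
    (hμ1 : μ < 1) (he : ∀ t, 0 ≤ e t) (hb : Summable fun t => b t ^ 2)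
    (h : ∀ t, e (t + N) ≤ μ * e t + b t) : Summable fun t => e t ^ 2 := by
  have hpos : 0 < 1 - μ := by linarith
  have hsq : ∀ t, e (t + N) ^ 2 ≤ μ * e t ^ 2 + b t ^ 2 / (1 - μ) := by
    intro t
    have h1 : e (t + N) ^ 2 ≤ (μ * e t + b t) ^ 2 := pow_le_pow_left₀ (he _) (h t) 2
    -- Convexity of the square with weights `μ` and `1 - μ`, at the points `e t` and `b t / (1 -
    -- μ)`.
    have h2 : μ * e t ^ 2 + b t ^ 2 / (1 - μ) - (μ * e t + b t) ^ 2
        = μ / (1 - μ) * ((1 - μ) * e t - b t) ^ 2 := by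
      field_simp
      ring
    have h3 : 0 ≤ μ / (1 - μ) * ((1 - μ) * e t - b t) ^ 2 := by positivity
    linarith
  refine summable_of_sum_range_le (c := (∑ t ∈ Finset.range N, e t ^ 2
    + (∑' t, b t ^ 2) / (1 - μ)) / (1 - μ)) (fun t => sq_nonneg _) fun T => ?_
  rw [le_div_iff₀ hpos]
  have h1 : ∑ t ∈ Finset.range T, e t ^ 2 ≤ ∑ t ∈ Finset.range (N + T), e t ^ 2 :=
    Finset.sum_le_sum_of_subset_of_nonneg (Finset.range_mono (by omega)) fun t _ _ => sq_nonneg _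
  rw [Finset.sum_range_add] at h1
  have h2 : ∑ t ∈ Finset.range T, e (N + t) ^ 2
      ≤ μ * ∑ t ∈ Finset.range T, e t ^ 2 + (∑ t ∈ Finset.range T, b t ^ 2) / (1 - μ) := by
    rw [Finset.mul_sum, Finset.sum_div, ← Finset.sum_add_distrib]
    exact Finset.sum_le_sum fun t _ => by rw [add_comm N]; exact hsq t
  have h3 : (∑ t ∈ Finset.range T, b t ^ 2) / (1 - μ) ≤ (∑' t, b t ^ 2) / (1 - μ) :=
    div_le_div_of_nonneg_right (hb.sum_le_tsum _ fun t _ => sq_nonneg _) hpos.le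
  linarith

/-! ### Quasi-Fejér sequences on the line -/

/-- A sequence of nonnegative reals that decreases up to a summable perturbation converges, and
its decrements are summable. -/
theorem quasi_fejer {a s c : ℕ → ℝ} (ha : ∀ t, 0 ≤ a t) (hs : ∀ t, 0 ≤ s t) (hc : ∀ t, 0 ≤ c t)
    (hsum : Summable c) (h : ∀ t, a (t + 1) ≤ a t - s t + c t) :
    Summable s ∧ ∃ l, Tendsto a atTop (𝓝 l) := by
  have hbound : ∀ t, a t + ∑ k ∈ Finset.range t, s k ≤ a 0 + ∑ k ∈ Finset.range t, c k := by
    intro t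
    induction t with
    | zero => simp
    | succ t ih =>
      rw [Finset.sum_range_succ, Finset.sum_range_succ]
      linarith [h t]
  have hct : ∀ t, ∑ k ∈ Finset.range t, c k ≤ ∑' k, c k := fun t =>
    hsum.sum_le_tsum _ fun k _ => hc k
  have hss : Summable s := summable_of_sum_range_le (c := a 0 + ∑' k, c k) hs fun t => by
    linarith [hbound t, ha t, hct t]
  refine ⟨hss, ?_⟩
  set w : ℕ → ℝ := fun t => a t + ∑ k ∈ Finset.range t, s k - ∑ k ∈ Finset.range t, c k with hw
  have hanti : Antitone w := antitone_nat_of_succ_le fun t => by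
    simp only [hw, Finset.sum_range_succ]
    linarith [h t]
  have hbdd : BddBelow (Set.range w) := by
    refine ⟨-∑' k, c k, ?_⟩
    rintro _ ⟨t, rfl⟩
    have := Finset.sum_nonneg fun k (_ : k ∈ Finset.range t) => hs k
    simp only [hw]
    linarith [ha t, hct t]
  have hlim := ((tendsto_atTop_ciInf hanti hbdd).sub hss.hasSum.tendsto_sum_nat).add
    hsum.hasSum.tendsto_sum_nat
  exact ⟨_, hlim.congr fun t => by simp only [hw]; ring⟩

/-- If `α` is not summable but `α * g` is, then `g` is frequently small. -/
theorem frequently_lt_of_summable_mul {α g : ℕ → ℝ} (hα : ∀ t, 0 ≤ α t)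
    (hns : ¬ Summable α) (hs : Summable fun t => α t * g t) {ε : ℝ} (hε : 0 < ε) :
    ∃ᶠ t in atTop, g t < ε := by
  intro hcon
  refine hns ?_
  refine summable_of_isBigO_nat (g := fun t => α t * g t) hs ?_
  refine Asymptotics.IsBigO.of_bound (1 / ε) ?_
  filter_upwards [hcon] with t ht
  have ht' : ε ≤ g t := not_lt.1 ht
  have h0 : 0 ≤ α t * g t := mul_nonneg (hα t) (hε.le.trans ht')
  rw [Real.norm_of_nonneg (hα t), Real.norm_of_nonneg h0, one_div, inv_mul_eq_div, le_div_iff₀ hε]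
  exact mul_le_mul_of_nonneg_left ht' (hα t)

/-- Subgradient-type sequences on the line: if `y` is quasi-Fejér with respect to the minimizers of
a continuous function `F` and the step sizes are not summable, then `y` converges to a
minimizer. -/
theorem exists_isMinOn_tendsto {F : ℝ → ℝ} (hF : Continuous F) {α c y : ℕ → ℝ}
    (hα : ∀ t, 0 ≤ α t) (hns : ¬ Summable α) (hc : ∀ t, 0 ≤ c t) (hsum : Summable c)
    (hmin : ∃ z, IsMinOn F Set.univ z)
    (h : ∀ u, ∀ t, (y (t + 1) - u) ^ 2 ≤ (y t - u) ^ 2 - α t * (F (y t) - F u) + c t) :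
    ∃ z, IsMinOn F Set.univ z ∧ Tendsto y atTop (𝓝 z) := by
  obtain ⟨z, hz⟩ := hmin
  have key : ∀ u, IsMinOn F Set.univ u → Summable (fun t => α t * (F (y t) - F u)) ∧
      ∃ l, Tendsto (fun t => (y t - u) ^ 2) atTop (𝓝 l) := fun u hu =>
    quasi_fejer (fun t => sq_nonneg _)
      (fun t => mul_nonneg (hα t) (sub_nonneg.2 (isMinOn_univ_iff.1 hu _))) hc hsum (h u)
  obtain ⟨hs, l, hl⟩ := key z hz
  obtain ⟨φ, hφ, hφlt⟩ := extraction_forall_of_frequently fun k : ℕ =>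
    frequently_lt_of_summable_mul hα hns hs (Nat.one_div_pos_of_nat (α := ℝ) (n := k))
  obtain ⟨M, hM⟩ := hl.bddAbove_range
  have hmem : ∀ k, (y ∘ φ) k ∈ Metric.closedBall z (Real.sqrt M) := fun k => by
    rw [Metric.mem_closedBall, Real.dist_eq]
    exact Real.abs_le_sqrt (hM ⟨φ k, rfl⟩)
  obtain ⟨v, -, ψ, hψ, hv⟩ := tendsto_subseq_of_bounded Metric.isBounded_closedBall hmem
  have hFv : F v ≤ F z := by
    have h1 : Tendsto (fun k => F (y (φ (ψ k))) - F z) atTop (𝓝 (F v - F z)) :=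
      ((hF.tendsto v).comp hv).sub_const _
    have h2 : Tendsto (fun k => 1 / ((ψ k : ℝ) + 1)) atTop (𝓝 0) :=
      (tendsto_one_div_add_atTop_nhds_zero_nat (𝕜 := ℝ)).comp hψ.tendsto_atTop
    linarith [le_of_tendsto_of_tendsto' h1 h2 fun k => (hφlt (ψ k)).le]
  have hvmin : IsMinOn F Set.univ v :=
    isMinOn_univ_iff.2 fun w => hFv.trans (isMinOn_univ_iff.1 hz w)
  refine ⟨v, hvmin, ?_⟩
  -- The cluster point is itself a minimizer, so the distance to it converges; the subsequence shows
  -- that the limit is zero.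
  obtain ⟨-, l', hl'⟩ := key v hvmin
  have h1 : Tendsto (fun k => (y (φ (ψ k)) - v) ^ 2) atTop (𝓝 0) := by
    simpa using (hv.sub_const v).pow 2
  have h2 := hl'.comp (hφ.comp hψ).tendsto_atTop
  rw [tendsto_nhds_unique h2 h1] at hl'
  have h3 := hl'.sqrt
  simp only [Real.sqrt_sq_eq_abs, Real.sqrt_zero] at h3
  exact tendsto_sub_nhds_zero_iff.1 (tendsto_zero_iff_abs_tendsto_zero _ |>.2 h3)

/-! ### Existence of subgradients -/

/-- A convex function on the line has a subgradient at every point. -/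
theorem ConvexOn.exists_isSubgradientAt {f : ℝ → ℝ} (hf : ConvexOn ℝ Set.univ f) (x : ℝ) :
    ∃ g, IsSubgradientAt f x g := by
  refine ⟨derivWithin f (Set.Ioi x) x, fun z => ?_⟩
  have hx : x ∈ interior (Set.univ : Set ℝ) := by simp
  rcases lt_trichotomy x z with h | rfl | h
  · have := hf.rightDeriv_le_slope_of_mem_interior hx (Set.mem_univ z) h
    rw [slope_def_field, le_div_iff₀ (by linarith)] at this
    linarith
  · simp
  · have := (hf.slope_le_leftDeriv_of_mem_interior (Set.mem_univ z) hx h).trans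
      (hf.leftDeriv_le_rightDeriv_of_mem_interior hx)
    rw [slope_def_field, div_le_iff₀ (by linarith)] at this
    linarith

/-! ### Spread of a vector and its contraction by stochastic matrices -/

section Spread

variable {ι : Type*}

/-- The largest difference between two entries of a vector. -/
noncomputable def spread (w : ι → ℝ) : ℝ := ⨆ p : ι × ι, (w p.1 - w p.2)

theorem spread_le [Nonempty ι] {w : ι → ℝ} {D : ℝ} (h : ∀ i j, w i - w j ≤ D) : spread w ≤ D :=
  ciSup_le fun p => h p.1 p.2

variable [Fintype ι]

theorem sub_le_spread (w : ι → ℝ) (i j : ι) : w i - w j ≤ spread w :=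
  le_ciSup (f := fun p : ι × ι => w p.1 - w p.2) (Set.finite_range _).bddAbove (i, j)

theorem spread_nonneg [Nonempty ι] (w : ι → ℝ) : 0 ≤ spread w := by
  obtain ⟨i⟩ := ‹Nonempty ι›
  simpa using sub_le_spread w i i

theorem dotProduct_le_of_mem_stdSimplex {p w : ι → ℝ} {C : ℝ} (hp : p ∈ stdSimplex ℝ ι)
    (hw : ∀ j, w j ≤ C) : p ⬝ᵥ w ≤ C := by
  calc p ⬝ᵥ w ≤ ∑ j, p j * C := Finset.sum_le_sum fun j _ =>
        mul_le_mul_of_nonneg_left (hw j) (hp.1 j)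
    _ = C := by rw [← Finset.sum_mul, hp.2, one_mul]

theorem abs_dotProduct_le_of_mem_stdSimplex {p w : ι → ℝ} {C : ℝ} (hp : p ∈ stdSimplex ℝ ι)
    (hw : ∀ j, |w j| ≤ C) : |p ⬝ᵥ w| ≤ C := by
  refine abs_le'.2 ⟨dotProduct_le_of_mem_stdSimplex hp fun j => (le_abs_self _).trans (hw j), ?_⟩
  rw [← dotProduct_neg]
  exact dotProduct_le_of_mem_stdSimplex hp fun j => (neg_le_abs _).trans (hw j)

theorem dotProduct_sub_dotProduct_le_spread {p r : ι → ℝ} (hp : p ∈ stdSimplex ℝ ι)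
    (hr : r ∈ stdSimplex ℝ ι) (w : ι → ℝ) : p ⬝ᵥ w - r ⬝ᵥ w ≤ spread w := by
  have h1 : ∀ j, p ⬝ᵥ w ≤ spread w + w j := fun j =>
    dotProduct_le_of_mem_stdSimplex hp fun k => by linarith [sub_le_spread w k j]
  have h2 : r ⬝ᵥ (-w) ≤ spread w - p ⬝ᵥ w :=
    dotProduct_le_of_mem_stdSimplex hr fun j => by
      rw [Pi.neg_apply]
      linarith [h1 j]
  rw [dotProduct_neg] at h2
  linarith

theorem abs_dotProduct_sub_dotProduct_le_spread {p r : ι → ℝ} (hp : p ∈ stdSimplex ℝ ι)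
    (hr : r ∈ stdSimplex ℝ ι) (w : ι → ℝ) : |p ⬝ᵥ w - r ⬝ᵥ w| ≤ spread w :=
  abs_sub_le_iff.2 ⟨dotProduct_sub_dotProduct_le_spread hp hr w,
    dotProduct_sub_dotProduct_le_spread hr hp w⟩

theorem abs_sub_dotProduct_le_spread [DecidableEq ι] {p : ι → ℝ} (hp : p ∈ stdSimplex ℝ ι)
    (w : ι → ℝ) (i : ι) : |w i - p ⬝ᵥ w| ≤ spread w := by
  simpa using abs_dotProduct_sub_dotProduct_le_spread (single_mem_stdSimplex ℝ i) hp w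

theorem row_mem_stdSimplex [DecidableEq ι] {P : Matrix ι ι ℝ}
    (hP : P ∈ Matrix.rowStochastic ℝ ι) (i : ι) : P i ∈ stdSimplex ℝ ι :=
  ⟨fun _ => Matrix.nonneg_of_mem_rowStochastic hP, Matrix.sum_row_of_mem_rowStochastic hP i⟩

/-- A stochastic matrix with a column bounded below by `δ` contracts the spread by `1 - δ`. -/
theorem spread_mulVec_le [Nonempty ι] [DecidableEq ι] {P : Matrix ι ι ℝ}
    (hP : P ∈ Matrix.rowStochastic ℝ ι) {δ : ℝ} {r : ι} (hr : ∀ i, δ ≤ P i r) (w : ι → ℝ) :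
    spread (P.mulVec w) ≤ (1 - δ) * spread w := by
  obtain ⟨a, ha⟩ := Finite.exists_max w
  obtain ⟨b, hb⟩ := Finite.exists_min w
  have hδ : δ ≤ 1 := (hr r).trans (Matrix.le_one_of_mem_rowStochastic hP)
  -- Removing `δ` from column `r` leaves nonnegative rows of sum `1 - δ`; the removed part `δ * w r`
  -- is the same in all rows and cancels in differences.
  have hQ : ∀ i k, 0 ≤ P i k - if k = r then δ else 0 := by
    intro i k
    split_ifs with h
    · subst h
      linarith [hr i]
    · simpa using Matrix.nonneg_of_mem_rowStochastic hP
  have hsum : ∀ i, ∑ k, (P i k - if k = r then δ else 0) = 1 - δ := by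
    intro i
    rw [Finset.sum_sub_distrib, Matrix.sum_row_of_mem_rowStochastic hP]
    simp
  have hexp : ∀ i, P.mulVec w i = ∑ k, (P i k - if k = r then δ else 0) * w k + δ * w r := by
    intro i
    simp [Matrix.mulVec, dotProduct, sub_mul, Finset.sum_sub_distrib]
  have hub : ∀ i, P.mulVec w i ≤ (1 - δ) * w a + δ * w r := by
    intro i
    rw [hexp, ← hsum i, Finset.sum_mul]
    exact add_le_add_left (Finset.sum_le_sum fun k _ =>
      mul_le_mul_of_nonneg_left (ha k) (hQ i k)) _
  have hlb : ∀ i, (1 - δ) * w b + δ * w r ≤ P.mulVec w i := by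
    intro i
    rw [hexp, ← hsum i, Finset.sum_mul]
    exact add_le_add_left (Finset.sum_le_sum fun k _ =>
      mul_le_mul_of_nonneg_left (hb k) (hQ i k)) _
  refine spread_le fun i j => ?_
  have h1 := mul_le_mul_of_nonneg_left (sub_le_spread w a b) (sub_nonneg.2 hδ)
  linarith [hub i, hlb j]

theorem spread_le_add [Nonempty ι] {v w : ι → ℝ} {ε : ℝ} (h : ∀ i, |v i - w i| ≤ ε) :
    spread v ≤ spread w + 2 * ε :=
  spread_le fun i j => by
    linarith [sub_le_spread w i j, (abs_le.1 (h i)).2, (abs_le.1 (h j)).1]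

/-- Each coordinate deviates from the average by at most the spread. The sharper factor `√n` is not
needed. -/
theorem consensusError_le {n : ℕ} {w : Fin n → ℝ} {p : Fin n → ℝ}
    (hp : p ∈ stdSimplex ℝ (Fin n)) : consensusError w (p ⬝ᵥ w) ≤ n * spread w := by
  have : Nonempty (Fin n) := by
    by_contra h
    rw [not_nonempty_iff] at h
    simpa using hp.2
  have h1 : ∀ i, (w i - p ⬝ᵥ w) ^ 2 ≤ spread w ^ 2 := fun i =>
    sq_le_sq.2 ((abs_sub_dotProduct_le_spread hp w i).trans (le_abs_self _))
  have hn : (1 : ℝ) ≤ n := by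
    have := Fin.pos (Classical.arbitrary (Fin n))
    exact_mod_cast this
  rw [consensusError, EuclideanSpace.norm_eq]
  refine Real.sqrt_le_iff.2 ⟨mul_nonneg (by positivity) (spread_nonneg w), ?_⟩
  calc ∑ i, ‖w i - p ⬝ᵥ w‖ ^ 2 ≤ ∑ _i : Fin n, spread w ^ 2 :=
        Finset.sum_le_sum fun i _ => by rw [Real.norm_eq_abs, sq_abs]; exact h1 i
    _ = n * spread w ^ 2 := by simp
    _ ≤ (n * spread w) ^ 2 := by
        rw [mul_pow]
        exact mul_le_mul_of_nonneg_right (by nlinarith) (sq_nonneg _)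

end Spread

/-! ### Backward products of stochastic matrices -/

section BackwardProduct

variable {ι : Type*} [Fintype ι] [DecidableEq ι]

/-- The product `A(s + k - 1) ⋯ A(s)` of `k` consecutive matrices. -/
def backwardProd (A : ℕ → Matrix ι ι ℝ) (s : ℕ) : ℕ → Matrix ι ι ℝ
  | 0 => 1
  | k + 1 => A (s + k) * backwardProd A s k

theorem backwardProd_mem {A : ℕ → Matrix ι ι ℝ} (hA : ∀ t, A t ∈ Matrix.rowStochastic ℝ ι)
    (s k : ℕ) : backwardProd A s k ∈ Matrix.rowStochastic ℝ ι := by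
  induction k with
  | zero => exact one_mem _
  | succ k ih => exact mul_mem (hA _) ih

theorem backwardProd_add (A : ℕ → Matrix ι ι ℝ) (s k l : ℕ) :
    backwardProd A s (k + l) = backwardProd A (s + k) l * backwardProd A s k := by
  induction l with
  | zero => simp [backwardProd]
  | succ l ih => rw [← add_assoc, backwardProd, ih, backwardProd, Matrix.mul_assoc, add_assoc]

/-- `Φ(s + k, s)` has `k + 1` factors, hence the shift by one. -/
theorem transitionMatrix_add {n : ℕ} (A : ℕ → Matrix (Fin n) (Fin n) ℝ) (s k : ℕ) :
    transitionMatrix A (s + k) s = backwardProd A s (k + 1) := by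
  induction k with
  | zero => cases s <;> simp [transitionMatrix, backwardProd]
  | succ k ih =>
    rw [← add_assoc, transitionMatrix, if_neg (by omega), ih, backwardProd]
    rfl

/-- A proper vertex set that contains the root of a digraph has an outgoing edge. -/
theorem exists_adj_of_reflTransGen {V : Type*} {H : Digraph V} {r v : V} {S : Set V}
    (h : Relation.ReflTransGen H.Adj r v) (hr : r ∈ S) (hv : v ∉ S) :
    ∃ j ∈ S, ∃ i ∉ S, H.Adj j i := by
  induction h with
  | refl => exact absurd hr hv
  | @tail b c _ hbc ih =>
    by_cases hb : b ∈ S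
    · exact ⟨b, hb, c, hv, hbc⟩
    · exact ih hb

/-- The entries of column `r` of a product of `k` matrices that are at least `β ^ k` are all, or
at least one more than the number of times at which `r` is a root. -/
theorem card_large_entries {A : ℕ → Matrix ι ι ℝ} (hA : ∀ t, A t ∈ Matrix.rowStochastic ℝ ι)
    {β : ℝ} (hβ : 0 < β) (hdiag : ∀ t i, β ≤ A t i i) {H : ℕ → Digraph ι}
    (hH : ∀ t i j, (H t).Adj j i → β ≤ A t i j) {root : ℕ → ι}
    (hroot : ∀ t v, Relation.ReflTransGen (H t).Adj (root t) v) (s : ℕ) (r : ι) (k : ℕ) :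
    β ^ k ≤ backwardProd A s k r r ∧
    ((∀ i, β ^ k ≤ backwardProd A s k i r) ∨
      ((Finset.range k).filter fun m => root (s + m) = r).card + 1
        ≤ (Finset.univ.filter fun i => β ^ k ≤ backwardProd A s k i r).card) := by
  -- A large entry propagates along an edge or self-loop at the cost of one factor `β`.
  have hstep : ∀ k i j, β ≤ A (s + k) i j → β ^ k ≤ backwardProd A s k j r →
      β ^ (k + 1) ≤ backwardProd A s (k + 1) i r := by
    intro k i j h1 h2
    rw [backwardProd, Matrix.mul_apply, pow_succ']
    calc β * β ^ k ≤ A (s + k) i j * backwardProd A s k j r :=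
          mul_le_mul h1 h2 (by positivity) (hβ.le.trans h1)
      _ ≤ _ := Finset.single_le_sum
          (f := fun j => A (s + k) i j * backwardProd A s k j r)
          (fun j _ => mul_nonneg (Matrix.nonneg_of_mem_rowStochastic (hA _))
            (Matrix.nonneg_of_mem_rowStochastic (backwardProd_mem hA s k))) (Finset.mem_univ j)
  induction k with
  | zero =>
    have h0 : β ^ 0 ≤ backwardProd A s 0 r r := by simp [backwardProd]
    refine ⟨h0, Or.inr ?_⟩
    rw [Finset.range_zero, Finset.filter_empty, Finset.card_empty, zero_add]
    exact Finset.card_pos.2 ⟨r, Finset.mem_filter.2 ⟨Finset.mem_univ r, h0⟩⟩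
  | succ k ih =>
    obtain ⟨hrr, ih⟩ := ih
    refine ⟨hstep k r r (hdiag _ r) hrr, ?_⟩
    by_cases hall : ∀ i, β ^ k ≤ backwardProd A s k i r
    · exact Or.inl fun i => hstep k i i (hdiag _ i) (hall i)
    refine Or.inr ?_
    replace ih := ih.resolve_left hall
    have hsub : (Finset.univ.filter fun i => β ^ k ≤ backwardProd A s k i r) ⊆
        Finset.univ.filter fun i => β ^ (k + 1) ≤ backwardProd A s (k + 1) i r := by
      intro i hi
      rw [Finset.mem_filter] at hi ⊢
      exact ⟨hi.1, hstep k i i (hdiag _ i) hi.2⟩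
    rw [Finset.range_add_one, Finset.filter_insert]
    split_ifs with hk
    · rw [Finset.card_insert_of_notMem (by simp)]
      push Not at hall
      obtain ⟨v, hv⟩ := hall
      -- The set of large rows contains the current root `r` but misses `v`, so an edge leaves it
      -- and adds a new row.
      obtain ⟨j, hj, i, hi, hji⟩ := exists_adj_of_reflTransGen (hroot (s + k) v)
        (S := {i | β ^ k ≤ backwardProd A s k i r}) (by rw [hk]; exact hrr) (not_le.2 hv)
      refine (Nat.succ_le_succ ih).trans (Finset.card_lt_card
        (Finset.ssubset_iff_of_subset hsub |>.2 ⟨i, ?_, ?_⟩))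
      · exact Finset.mem_filter.2 ⟨Finset.mem_univ i, hstep k i j (hH _ i j hji) hj⟩
      · exact fun h => hi (Finset.mem_filter.1 h).2
    · exact ih.trans (Finset.card_le_card hsub)

/-- Over a window of length `|ι|²` some column of the product is bounded below. -/
theorem exists_column_ge [Nonempty ι] {A : ℕ → Matrix ι ι ℝ}
    (hA : ∀ t, A t ∈ Matrix.rowStochastic ℝ ι)
    {β : ℝ} (hβ : 0 < β) (hdiag : ∀ t i, β ≤ A t i i) {H : ℕ → Digraph ι}
    (hH : ∀ t i j, (H t).Adj j i → β ≤ A t i j) (hroot : ∀ t, (H t).IsRooted) (s : ℕ) :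
    ∃ r, ∀ i, β ^ (Fintype.card ι * Fintype.card ι) ≤
      backwardProd A s (Fintype.card ι * Fintype.card ι) i r := by
  choose root hroot using hroot
  -- Pigeonhole: some `r` is the root at `card ι` times or more. The second alternative below would
  -- then give more than `card ι` large rows.
  obtain ⟨r, -, hr⟩ := Finset.exists_le_card_fiber_of_mul_le_card_of_maps_to
    (s := Finset.range (Fintype.card ι * Fintype.card ι)) (t := Finset.univ)
    (f := fun m => root (s + m)) (n := Fintype.card ι)
    (fun _ _ => Finset.mem_univ _) Finset.univ_nonempty (by simp)
  refine ⟨r, ?_⟩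
  rcases (card_large_entries hA hβ hdiag hH hroot s r (Fintype.card ι * Fintype.card ι)).2
    with h | h
  · exact h
  · have := h.trans (Finset.card_le_univ _)
    omega

/-- The contraction of the spread over a window, with a factor independent of the window. -/
theorem exists_spread_contraction [Nonempty ι] {A : ℕ → Matrix ι ι ℝ}
    (hA : ∀ t, A t ∈ Matrix.rowStochastic ℝ ι)
    {β : ℝ} (hβ : 0 < β) (hdiag : ∀ t i, β ≤ A t i i) {H : ℕ → Digraph ι}
    (hH : ∀ t i j, (H t).Adj j i → β ≤ A t i j) (hroot : ∀ t, (H t).IsRooted) :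
    ∃ N : ℕ, 0 < N ∧ ∃ μ : ℝ, 0 ≤ μ ∧ μ < 1 ∧
      ∀ s w, spread ((backwardProd A s N).mulVec w) ≤ μ * spread w := by
  have hβ1 : β ≤ 1 := (hdiag 0 (Classical.arbitrary ι)).trans
    (Matrix.le_one_of_mem_rowStochastic (hA 0))
  refine ⟨Fintype.card ι * Fintype.card ι, mul_pos Fintype.card_pos Fintype.card_pos,
    1 - β ^ (Fintype.card ι * Fintype.card ι), sub_nonneg.2 (pow_le_one₀ hβ.le hβ1),
    sub_lt_self _ (by positivity), fun s w => ?_⟩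
  obtain ⟨r, hr⟩ := exists_column_ge hA hβ hdiag hH hroot s
  exact spread_mulVec_le (backwardProd_mem hA s _) hr w

/-- Backward products whose windows contract the spread converge to a rank-one matrix with equal
stochastic rows. -/
theorem exists_tendsto_backwardProd [Nonempty ι] {A : ℕ → Matrix ι ι ℝ}
    (hA : ∀ t, A t ∈ Matrix.rowStochastic ℝ ι) {N : ℕ} (hN : 0 < N) {μ : ℝ} (hμ0 : 0 ≤ μ)
    (hμ1 : μ < 1) (hcon : ∀ s w, spread ((backwardProd A s N).mulVec w) ≤ μ * spread w) (s : ℕ) :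
    ∃ q ∈ stdSimplex ℝ ι, Tendsto (backwardProd A s) atTop (𝓝 (Matrix.of fun _ j => q j)) := by
  have hcol : ∀ j k i, (backwardProd A s k).mulVec (Pi.single j 1) i = backwardProd A s k i j :=
    fun j k i => by simp
  have hspread : ∀ j, Tendsto (fun k => spread ((backwardProd A s k).mulVec (Pi.single j 1)))
      atTop (𝓝 0) := fun j =>
    tendsto_zero_of_contraction_lag hN hμ0 hμ1 (fun k => spread_nonneg _)
      (tendsto_const_nhds (x := (0 : ℝ))) fun k => by
        rw [backwardProd_add, ← Matrix.mulVec_mulVec, add_zero]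
        exact hcon _ _
  have hlim : ∀ i j, ∃ l, Tendsto (fun k => backwardProd A s k i j) atTop (𝓝 l) := by
    intro i j
    refine cauchySeq_tendsto_of_complete (cauchySeq_of_le_tendsto_0' _ (fun k m hkm => ?_)
      (hspread j))
    obtain ⟨l, rfl⟩ := Nat.exists_eq_add_of_le hkm
    -- A later entry is a stochastic average of the earlier column, so it differs from the earlier
    -- entry by at most that column's spread.
    rw [Real.dist_eq, ← hcol j k, ← hcol j (k + l), backwardProd_add, ← Matrix.mulVec_mulVec]
    exact abs_sub_dotProduct_le_spread (row_mem_stdSimplex (backwardProd_mem hA _ _) i) _ i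
  choose l hl using hlim
  have hleq : ∀ i i' j, l i j = l i' j := by
    have hle : ∀ i i' j, l i j - l i' j ≤ 0 := fun i i' j =>
      le_of_tendsto_of_tendsto' ((hl i j).sub (hl i' j)) (hspread j) fun k => by
        rw [← hcol j k i, ← hcol j k i']
        exact sub_le_spread _ i i'
    exact fun i i' j => le_antisymm (sub_nonpos.1 (hle i i' j)) (sub_nonpos.1 (hle i' i j))
  let a := Classical.arbitrary ι
  refine ⟨l a, ?_, ?_⟩
  · exact (isClosed_stdSimplex ℝ ι).mem_of_tendsto (tendsto_pi_nhds.2 fun j => hl a j)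
      (Eventually.of_forall fun k => row_mem_stdSimplex (backwardProd_mem hA s k) a)
  · refine tendsto_pi_nhds.2 fun i => tendsto_pi_nhds.2 fun j => ?_
    rw [Matrix.of_apply, hleq a i j]
    exact hl i j

end BackwardProduct

/-! ### The perturbed trajectory and its weighted average -/

section Dynamics

variable {n : ℕ} {A : ℕ → Matrix (Fin n) (Fin n) ℝ} {α : ℕ → ℝ} {x d : ℕ → Fin n → ℝ} {L : ℝ}

/-- The perturbed trajectory stays close to the unperturbed one. -/
theorem abs_sub_backwardProd_le (hA : ∀ t, A t ∈ Matrix.rowStochastic ℝ (Fin n))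
    (hα : ∀ t, 0 ≤ α t) (hd : ∀ t i, |d t i| ≤ L)
    (hx : ∀ t, x (t + 1) = (A t).mulVec (x t) - α t • d t) (t k : ℕ) (i : Fin n) :
    |x (t + k) i - (backwardProd A t k).mulVec (x t) i| ≤
      L * ∑ j ∈ Finset.range k, α (t + j) := by
  induction k generalizing i with
  | zero => simp [backwardProd]
  | succ k ih =>
    have h1 : x (t + (k + 1)) i - (backwardProd A t (k + 1)).mulVec (x t) i =
        A (t + k) i ⬝ᵥ (x (t + k) - (backwardProd A t k).mulVec (x t))
          - α (t + k) * d (t + k) i := by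
      rw [← add_assoc, hx, backwardProd, ← Matrix.mulVec_mulVec, dotProduct_sub]
      simp only [Pi.sub_apply, Pi.smul_apply, smul_eq_mul, Matrix.mulVec]
      ring
    have h2 := abs_dotProduct_le_of_mem_stdSimplex (row_mem_stdSimplex (hA (t + k)) i) ih
    have h3 : |α (t + k) * d (t + k) i| ≤ L * α (t + k) := by
      rw [abs_mul, abs_of_nonneg (hα _), mul_comm]
      exact mul_le_mul_of_nonneg_right (hd _ _) (hα _)
    rw [h1, Finset.sum_range_succ, mul_add]
    exact (abs_sub _ _).trans (add_le_add h2 h3)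

/-- The factor `2` appears because the two entries being compared may each be displaced by the
accumulated perturbation. -/
theorem spread_add_le [Nonempty (Fin n)] (hA : ∀ t, A t ∈ Matrix.rowStochastic ℝ (Fin n))
    (hα : ∀ t, 0 ≤ α t) (hd : ∀ t i, |d t i| ≤ L)
    (hx : ∀ t, x (t + 1) = (A t).mulVec (x t) - α t • d t) {N : ℕ} {μ : ℝ}
    (hcon : ∀ s w, spread ((backwardProd A s N).mulVec w) ≤ μ * spread w) (t : ℕ) :
    spread (x (t + N)) ≤ μ * spread (x t) + 2 * (L * ∑ j ∈ Finset.range N, α (t + j)) :=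
  (spread_le_add (abs_sub_backwardProd_le hA hα hd hx t N)).trans
    (add_le_add_left (hcon _ _) _)

theorem tendsto_spread_zero [Nonempty (Fin n)] (hA : ∀ t, A t ∈ Matrix.rowStochastic ℝ (Fin n))
    (hα : ∀ t, 0 ≤ α t) (hd : ∀ t i, |d t i| ≤ L)
    (hx : ∀ t, x (t + 1) = (A t).mulVec (x t) - α t • d t) {N : ℕ} (hN : 0 < N) {μ : ℝ}
    (hμ0 : 0 ≤ μ) (hμ1 : μ < 1)
    (hcon : ∀ s w, spread ((backwardProd A s N).mulVec w) ≤ μ * spread w)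
    (hα0 : Tendsto α atTop (𝓝 0)) : Tendsto (fun t => spread (x t)) atTop (𝓝 0) := by
  refine tendsto_zero_of_contraction_lag hN hμ0 hμ1 (fun t => spread_nonneg _) ?_
    (spread_add_le hA hα hd hx hcon)
  have := ((tendsto_finsetSum (Finset.range N) fun j _ =>
    hα0.comp (tendsto_add_atTop_nat j)).const_mul L).const_mul 2
  simpa using this

/-- By Cauchy–Schwarz over a window of `N` step sizes the forcing term is square-summable, hence so
is the spread, and the product is bounded by the sum of the squares. -/
theorem summable_mul_spread [Nonempty (Fin n)]
    (hA : ∀ t, A t ∈ Matrix.rowStochastic ℝ (Fin n))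
    (hα : ∀ t, 0 ≤ α t) (hd : ∀ t i, |d t i| ≤ L)
    (hx : ∀ t, x (t + 1) = (A t).mulVec (x t) - α t • d t) {N : ℕ} {μ : ℝ}
    (hμ0 : 0 ≤ μ) (hμ1 : μ < 1)
    (hcon : ∀ s w, spread ((backwardProd A s N).mulVec w) ≤ μ * spread w)
    (hα2 : Summable fun t => α t ^ 2) : Summable fun t => α t * spread (x t) := by
  have hb : Summable fun t => (2 * (L * ∑ j ∈ Finset.range N, α (t + j))) ^ 2 := by
    have h1 : Summable fun t => 4 * L ^ 2 * (N * ∑ j ∈ Finset.range N, α (t + j) ^ 2) :=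
      ((summable_sum fun j _ => (summable_nat_add_iff j).2 hα2).mul_left _).mul_left _
    refine h1.of_nonneg_of_le (fun t => sq_nonneg _) fun t => ?_
    have h2 := sq_sum_le_card_mul_sum_sq (s := Finset.range N) (f := fun j => α (t + j))
    rw [Finset.card_range] at h2
    calc _ = 4 * L ^ 2 * (∑ j ∈ Finset.range N, α (t + j)) ^ 2 := by ring
      _ ≤ _ := mul_le_mul_of_nonneg_left h2 (by positivity)
  have he := summable_sq_of_contraction_lag hμ0 hμ1 (fun t => spread_nonneg (x t)) hb
    (spread_add_le hA hα hd hx hcon)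
  refine (hα2.add he).of_nonneg_of_le (fun t => mul_nonneg (hα t) (spread_nonneg _)) fun t => ?_
  nlinarith [sq_nonneg (α t - spread (x t)), sq_nonneg (α t), sq_nonneg (spread (x t))]

/-- A subgradient inequality at a nearby point: `d` is a subgradient of `f` at `z`. -/
theorem IsSubgradientAt.mul_sub_ge {f : ℝ → ℝ} (hf : ConvexOn ℝ Set.univ f)
    (hL : ∀ z g, IsSubgradientAt f z g → |g| ≤ L) {z g : ℝ} (hg : IsSubgradientAt f z g)
    {y u ε : ℝ} (hε : |z - y| ≤ ε) : f y - f u - 2 * (L * ε) ≤ g * (y - u) := by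
  -- One `L * ε` pays for replacing `f z` by `f y`, through a subgradient at `y`; the other for
  -- replacing `z` by `y` in `g * (z - u)`.
  obtain ⟨h, hh⟩ := hf.exists_isSubgradientAt y
  have hmul : ∀ {a : ℝ}, |a| ≤ L → |a * (z - y)| ≤ L * ε := fun {a} ha => by
    rw [abs_mul]
    exact mul_le_mul ha hε (abs_nonneg _) ((abs_nonneg _).trans ha)
  have h1 := hg u
  have h2 := hh z
  have h3 := (abs_le.1 (hmul (hL _ _ hh))).1
  have h4 := (abs_le.1 (hmul (hL _ _ hg))).2
  linarith

theorem ConvexOn.continuous_univ {f : ℝ → ℝ} (hf : ConvexOn ℝ Set.univ f) : Continuous f :=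
  continuousOn_univ.1 (hf.continuousOn isOpen_univ)

/-- The weighted average of the states decreases the squared distance to any point `u`, up to the
gap of the weighted objective and an error controlled by the spread. -/
theorem sq_average_sub_le {p : Fin n → ℝ} (hp : p ∈ stdSimplex ℝ (Fin n))
    (hA : ∀ t, A t ∈ Matrix.rowStochastic ℝ (Fin n)) (hpA : ∀ t, Matrix.vecMul p (A t) = p)
    {f : Fin n → ℝ → ℝ} (hf : ∀ i, ConvexOn ℝ Set.univ (f i))
    (hL : ∀ i z g, IsSubgradientAt (f i) z g → |g| ≤ L)
    (hα : ∀ t, 0 ≤ α t) (hx : FollowsDynamics A f α x d) (u : ℝ) (t : ℕ) :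
    (p ⬝ᵥ x (t + 1) - u) ^ 2 ≤ (p ⬝ᵥ x t - u) ^ 2
      - α t * (2 * ∑ i, p i * f i (p ⬝ᵥ x t) - 2 * ∑ i, p i * f i u)
      + (4 * L * (α t * spread (x t)) + L ^ 2 * α t ^ 2) := by
  set y := p ⬝ᵥ x t with hy
  -- Invariance of `p` removes `A t`: the average moves only by the subgradient step.
  have hstep : p ⬝ᵥ x (t + 1) = y - α t * (p ⬝ᵥ d t) := by
    rw [(hx t).2, dotProduct_sub, Matrix.dotProduct_mulVec, hpA, dotProduct_smul, smul_eq_mul]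
  -- Each `d t i` is taken at an entry of `A t * x t`, which, like `y`, is a stochastic average of
  -- `x t`, so the two points are within the spread.
  have hsub : ∑ i, p i * f i y - ∑ i, p i * f i u - 2 * (L * spread (x t)) ≤
      p ⬝ᵥ d t * (y - u) := by
    have h1 : ∀ i, p i * (f i y - f i u - 2 * (L * spread (x t))) ≤ p i * (d t i * (y - u)) :=
      fun i => mul_le_mul_of_nonneg_left (((hx t).1 i).mul_sub_ge (hf i) (hL i)
        (abs_dotProduct_sub_dotProduct_le_spread (row_mem_stdSimplex (hA t) i) hp _)) (hp.1 i)
    have h2 := Finset.sum_le_sum fun i (_ : i ∈ Finset.univ) => h1 i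
    simp only [mul_sub, Finset.sum_sub_distrib, ← Finset.sum_mul, hp.2, one_mul] at h2
    simp only [dotProduct, mul_sub, Finset.sum_mul]
    simp only [mul_assoc]
    linarith
  have hd : (p ⬝ᵥ d t) ^ 2 ≤ L ^ 2 := by
    have h := abs_dotProduct_le_of_mem_stdSimplex hp fun i => hL i _ _ ((hx t).1 i)
    exact sq_le_sq.2 (h.trans (le_abs_self _))
  rw [hstep]
  have h1 := mul_le_mul_of_nonneg_left hsub (hα t)
  have h2 := mul_le_mul_of_nonneg_left hd (sq_nonneg (α t))
  nlinarith

/-- A left fixed vector of all the matrices is a multiple of the limit vector of the backward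
products. -/
theorem eq_sum_mul_of_tendsto_backwardProd {q p : Fin n → ℝ}
    (hq : ∀ t, Matrix.vecMul q (A t) = q)
    (hlim : Tendsto (backwardProd A 0) atTop (𝓝 (Matrix.of fun _ j => p j))) (j : Fin n) :
    q j = (∑ i, q i) * p j := by
  have hfix : ∀ k, Matrix.vecMul q (backwardProd A 0 k) = q := by
    intro k
    induction k with
    | zero => simp [backwardProd]
    | succ k ih => rw [backwardProd, ← Matrix.vecMul_vecMul, hq, ih]
  have h1 : Tendsto (fun k => ∑ i, q i * backwardProd A 0 k i j) atTop (𝓝 (∑ i, q i * p j)) :=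
    tendsto_finsetSum _ fun i _ =>
      (tendsto_pi_nhds.1 (tendsto_pi_nhds.1 hlim i) j).const_mul _
  have h2 : ∀ k, ∑ i, q i * backwardProd A 0 k i j = q j := fun k => congrFun (hfix k) j
  simp only [h2] at h1
  rw [Finset.sum_mul]
  exact tendsto_nhds_unique tendsto_const_nhds h1

end Dynamics

/-! ### Consensus and convergence to an optimum -/

theorem mainTheorem9 (n : ℕ)
    -- communication graphs and weights
    (E : ℕ → Digraph (Fin n)) (A : ℕ → Matrix (Fin n) (Fin n) ℝ)
    (hA : ∀ t, IsConsensusWeights (E t) (A t))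
    (β : ℝ) (hβ : 0 < β) (hroot : ∀ t, HasRootedSubgraph (E t) (A t) β)
    -- convex objective functions with bounded subgradients
    (f : Fin n → ℝ → ℝ) (hf : ∀ i, ConvexOn ℝ Set.univ (f i))
    (L : ℝ) (hL : ∀ i z g, IsSubgradientAt (f i) z g → |g| ≤ L)
    -- step sizes and trajectory
    (α : ℕ → ℝ) (hα : ∀ t, 0 ≤ α t)
    (x d : ℕ → Fin n → ℝ) (hx : FollowsDynamics A f α x d) :
    (∃ q : ℕ → Fin n → ℝ, IsLimitVectors A q ∧
      (Tendsto α atTop (𝓝 0) →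
        Tendsto (fun t => consensusError (x t) (q t ⬝ᵥ x t)) atTop (𝓝 0)) ∧
      ((Summable fun t => α t ^ 2) →
        Summable fun t => α t * consensusError (x t) (q t ⬝ᵥ x t))) ∧
    (∀ q : Fin n → ℝ, (∀ t, Matrix.vecMul q (A t) = q) → 0 < ∑ i, q i →
      ¬ Summable α → (Summable fun t => α t ^ 2) →
      (∃ z, IsMinOn (fun u => ∑ i, q i * f i u) Set.univ z) →
      ∃ xstar, IsMinOn (fun u => ∑ i, q i * f i u) Set.univ xstar ∧
        ∀ i, Tendsto (fun t => x t i) atTop (𝓝 xstar)) := by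
  have hne : Nonempty (Fin n) := by
    obtain ⟨H, -, ⟨r, -⟩, -⟩ := (hroot 0).2
    exact ⟨r⟩
  have hS : ∀ t, A t ∈ Matrix.rowStochastic ℝ (Fin n) := fun t => (hA t).1
  have hd : ∀ t i, |d t i| ≤ L := fun t i => hL i _ _ ((hx t).1 i)
  have hL0 : 0 ≤ L := (abs_nonneg _).trans (hd 0 (Classical.arbitrary _))
  have hdyn : ∀ t, x (t + 1) = (A t).mulVec (x t) - α t • d t := fun t => (hx t).2
  choose H _ hHr hHβ using fun t => (hroot t).2
  obtain ⟨N, hN, μ, hμ0, hμ1, hcon⟩ :=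
    exists_spread_contraction hS hβ (fun t => (hroot t).1) hHβ hHr
  choose p hp hlim using exists_tendsto_backwardProd hS hN hμ0 hμ1 hcon
  have hspread := tendsto_spread_zero hS hα hd hdyn hN hμ0 hμ1 hcon
  have hsummable := summable_mul_spread hS hα hd hdyn hμ0 hμ1 hcon
  have herr0 : ∀ t, 0 ≤ consensusError (x t) (p t ⬝ᵥ x t) := fun t => norm_nonneg _
  refine ⟨⟨p, fun s => ⟨hp s, ?_⟩, fun h0 => ?_, fun h2 => ?_⟩, fun q hq hqpos hns h2 hmin => ?_⟩
  -- Only times `t ≥ s` matter, so the value `0` of `transitionMatrix` for `t < s` plays no role.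
  · rw [← tendsto_add_atTop_iff_nat s]
    simp only [add_comm _ s, transitionMatrix_add]
    exact (hlim s).comp (tendsto_add_atTop_nat 1)
  · exact squeeze_zero herr0 (fun t => consensusError_le (hp t))
      (by simpa using (hspread h0).const_mul (n : ℝ))
  · refine ((hsummable h2).mul_left (n : ℝ)).of_nonneg_of_le
      (fun t => mul_nonneg (hα t) (herr0 t)) fun t => ?_
    rw [mul_left_comm]
    exact mul_le_mul_of_nonneg_left (consensusError_le (hp t)) (hα t)
  have hqp : ∀ j, q j = (∑ i, q i) * p 0 j := eq_sum_mul_of_tendsto_backwardProd hq (hlim 0)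
  set c := ∑ i, q i with hc
  -- Since `q` is a positive multiple of the stochastic vector `p 0`, its entries are nonnegative
  -- and `p 0` inherits its invariance.
  have hpA : ∀ t, Matrix.vecMul (p 0) (A t) = p 0 := by
    have hq' : q = c • p 0 := funext hqp
    intro t
    have h := hq t
    rw [hq', Matrix.smul_vecMul] at h
    exact smul_right_injective _ hqpos.ne' h
  -- The factor `2` matches the cross term in the expanded square of `sq_average_sub_le`.
  have hmin_iff : ∀ z, IsMinOn (fun u => ∑ i, q i * f i u) Set.univ z ↔
      IsMinOn (fun u => 2 * ∑ i, p 0 i * f i u) Set.univ z := by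
    intro z
    have h : ∀ u, ∑ i, q i * f i u = c * ∑ i, p 0 i * f i u := fun u => by
      rw [Finset.mul_sum]
      exact Finset.sum_congr rfl fun i _ => by rw [hqp i, mul_assoc]
    simp only [isMinOn_univ_iff, h, mul_le_mul_iff_right₀ hqpos,
      mul_le_mul_iff_right₀ (two_pos (α := ℝ))]
  have hα0 : Tendsto α atTop (𝓝 0) := by
    have := h2.tendsto_atTop_zero.sqrt
    simpa only [Real.sqrt_sq (hα _), Real.sqrt_zero] using this
  obtain ⟨z, hz, hyz⟩ := exists_isMinOn_tendsto
    (F := fun u => 2 * ∑ i, p 0 i * f i u) (y := fun t => p 0 ⬝ᵥ x t)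
    (continuous_const.mul (continuous_finsetSum _ fun i _ =>
      continuous_const.mul (hf i).continuous_univ))
    hα hns
    (fun t => add_nonneg (mul_nonneg (by positivity) (mul_nonneg (hα t) (spread_nonneg (x t))))
      (by positivity))
    (((hsummable h2).mul_left (4 * L)).add (h2.mul_left (L ^ 2)))
    (hmin.imp fun z => (hmin_iff z).1)
    (sq_average_sub_le (hp 0) hS hpA hf hL hα hx)
  refine ⟨z, (hmin_iff z).2 hz, fun i => ?_⟩
  have h3 : Tendsto (fun t => x t i - p 0 ⬝ᵥ x t) atTop (𝓝 0) :=
    squeeze_zero_norm (fun t => abs_sub_dotProduct_le_spread (hp 0) (x t) i) (hspread hα0)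
  simpa using h3.add hyz
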